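/- All topological spaces are assumed completely regular and Hausdorff. For a space \(X\), write \(C(X)\) for the ring of continuous functions \(X\to\mathbb{R}\) and \(\beta X\supset X\) for the Stone–Čech compactification of \(X\). A point \(x\in\beta X\) is called real if every continuous function \(X\to\mathbb{R}\) extends to a continuous function \(X\cup\{x\}\to\mathbb{R}\); the realcompactification \(\upsilon X\) is the subspace of \(\beta X\) consisting of all real points. A functorial Lindelöfification of \(X\) is a continuous map \(i:X\to\nu X\) to a Lindelöf space \(\nu X\) such that for every Lindelöf space \(Y\) and every continuous map \(f:X\to Y\) there exists a unique continuous map \(\tilde f:\nu X\to Y\) with \(f=\tilde f\circ i\). Corollary. Let \(X\) be a topological space. Then the following assertions are equivalent: (i) \(X\) admits a functorial Lindelöfification. (ii) The realcompactification \(\upsilon X\) of \(X\) is Lindelöf. (iii) There exists a Lindelöf space \(Y\) such that \(C(X)\) is isomorphic as a ring to \(C(Y)\). -/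

import Mathlib

universe u

/-- A continuous map `i : X → νX` is a functorial `P`-ification of `X` (for a class `P` of topological
spaces, viewed as a full subcategory) if `νX` belongs to `P` and every continuous map from `X` to a member
`Y` of `P` factors through `i` by a unique continuous map `νX → Y`. -/
structure IsFunctorialPification (P : ∀ (Y : Type u) [TopologicalSpace Y], Prop)
    {X νX : Type u} [TopologicalSpace X] [TopologicalSpace νX] (i : C(X, νX)) : Prop where
  mem : P νX
  existsUnique_extension : ∀ (Y : Type u) [TopologicalSpace Y], P Y →
    ∀ f : C(X, Y), ∃! g : C(νX, Y), f = g.comp i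

/-- `X` admits a functorial `P`-ification. -/
def FunctoriallyPifiable (P : ∀ (Y : Type u) [TopologicalSpace Y], Prop)
    (X : Type u) [TopologicalSpace X] : Prop :=
  ∃ (νX : Type u) (_ : TopologicalSpace νX) (i : C(X, νX)), IsFunctorialPification P i

/-- The class of Lindelöf spaces, inside the completely regular Hausdorff spaces. -/
def Lind (Y : Type u) [TopologicalSpace Y] : Prop :=
  T35Space Y ∧ LindelofSpace Y

/-- A point `x` of the Stone-Čech compactification of `X` is real if every continuous function `X → ℝ`
extends to a continuous function on the subspace `X ∪ {x}` of the Stone-Čech compactification. -/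
def IsRealPoint {X : Type u} [TopologicalSpace X] (x : StoneCech X) : Prop :=
  ∀ f : C(X, ℝ), ∃ g : C((Set.range (stoneCechUnit : X → StoneCech X) ∪ {x} : Set (StoneCech X)), ℝ),
    ∀ a : X, g ⟨stoneCechUnit a, Or.inl ⟨a, rfl⟩⟩ = f a

/-- The realcompactification of `X`: the subspace of the Stone-Čech compactification formed by the
real points. -/
def Realcompactification (X : Type u) [TopologicalSpace X] : Set (StoneCech X) :=
  {x | IsRealPoint x}

open Topology

section RingHomToReal

variable {Y : Type*} [TopologicalSpace Y]

/-! A point of `βX` is real exactly when evaluation at it extends along restriction `C(βX) → C(X)`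
to a ring homomorphism `C(X) → ℝ`, a character. So characters of `C(X)` control `υX`. For Lindelöf
`Y`, every character of `C(Y)` is evaluation at a point (`ContinuousMap.exists_eval_of_ringHom`).

If `C(X) ≅ C(Y)` with `Y` Lindelöf, points of `Y` give characters of `C(X)`, hence real points, and
the resulting map `Y → υX` is a continuous surjection; so `υX` is Lindelöf. If `υX` is Lindelöf, the
extension `βX → βY` of a map from `X` to a Lindelöf `Y` sends real points into `Y`, so `υX` is
itself the Lindelöfification. Finally, testing a Lindelöfification against `ℝ` gives `C(X) ≅ C(νX)`.
-/

theorem ContinuousMap.ringHom_apply_const (χ : C(Y, ℝ) →+* ℝ) (c : ℝ) :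
    χ (ContinuousMap.const Y c) = c := by
  -- The identity is the only ring endomorphism of `ℝ`, so `χ` is automatically `ℝ`-linear.
  have h : χ.comp (algebraMap ℝ C(Y, ℝ)) = RingHom.id ℝ := Subsingleton.elim _ _
  exact congrArg (fun r : ℝ →+* ℝ => r c) h

theorem ContinuousMap.ringHom_nonneg (χ : C(Y, ℝ) →+* ℝ) {f : C(Y, ℝ)} (hf : ∀ y, 0 ≤ f y) :
    0 ≤ χ f := by
  have h : f = ⟨fun y => √(f y), by fun_prop⟩ * ⟨fun y => √(f y), by fun_prop⟩ := by
    ext y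
    simp [Real.mul_self_sqrt (hf y)]
  rw [h, map_mul]
  exact mul_self_nonneg _

theorem ContinuousMap.ringHom_mono (χ : C(Y, ℝ) →+* ℝ) {f g : C(Y, ℝ)} (h : ∀ y, f y ≤ g y) :
    χ f ≤ χ g := by
  rw [← sub_nonneg, ← map_sub]
  exact ContinuousMap.ringHom_nonneg χ fun y => by simpa using h y

theorem ContinuousMap.ringHom_ne_zero (χ : C(Y, ℝ) →+* ℝ) {f : C(Y, ℝ)} (hf : ∀ y, f y ≠ 0) :
    χ f ≠ 0 := by
  have h : f * ⟨fun y => (f y)⁻¹, f.continuous.inv₀ hf⟩ = 1 := by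
    ext y
    simp [hf y]
  intro h0
  have h1 := congrArg χ h
  rw [map_mul, h0, zero_mul, map_one] at h1
  exact zero_ne_one h1

/-- A countable family of functions in the kernel of a real character has a common zero. -/
theorem ContinuousMap.exists_common_zero_of_ringHom (χ : C(Y, ℝ) →+* ℝ) (F : ℕ → C(Y, ℝ))
    (hF : ∀ n, χ (F n) = 0) : ∃ y, ∀ n, F n y = 0 := by
  by_contra! hne
  -- Without a common zero, `∑ w n` is positive everywhere, hence a unit. Yet `χ` kills each term,
  -- and truncation by 1 bounds the tails uniformly by `2 * (1 / 2) ^ N`, so `χ` kills the sum too.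
  let w : ℕ → C(Y, ℝ) := fun n =>
    ⟨fun y => (1 / 2) ^ n * min (F n y ^ 2) 1, by fun_prop⟩
  have w_nonneg (n : ℕ) (y : Y) : 0 ≤ w n y := by
    change 0 ≤ (1 / 2 : ℝ) ^ n * min (F n y ^ 2) 1
    positivity
  have w_le (n : ℕ) (y : Y) : w n y ≤ (1 / 2) ^ n := by
    change (1 / 2 : ℝ) ^ n * min (F n y ^ 2) 1 ≤ _
    exact mul_le_of_le_one_right (by positivity) (min_le_right _ _)
  have w_summable (y : Y) : Summable fun n => w n y :=
    Summable.of_nonneg_of_le (fun n => w_nonneg n y) (fun n => w_le n y) summable_geometric_two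
  have χw (n : ℕ) : χ (w n) = 0 := by
    refine le_antisymm ?_ (ContinuousMap.ringHom_nonneg χ (w_nonneg n))
    calc χ (w n) ≤ χ (F n * F n) := ContinuousMap.ringHom_mono χ fun y => by
            change (1 / 2 : ℝ) ^ n * min (F n y ^ 2) 1 ≤ F n y * F n y
            rw [← pow_two]
            exact (mul_le_of_le_one_left (by positivity)
              (pow_le_one₀ (by norm_num) (by norm_num))).trans (min_le_left _ _)
      _ = 0 := by rw [map_mul, hF n, zero_mul]
  let g : C(Y, ℝ) := ⟨fun y => ∑' n, w n y,
    continuous_tsum (fun n => (w n).continuous) summable_geometric_two fun n y => by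
      rw [Real.norm_of_nonneg (w_nonneg n y)]
      exact w_le n y⟩
  have g_pos (y : Y) : 0 < g y := by
    obtain ⟨n, hn⟩ := hne y
    refine (w_summable y).tsum_pos (fun n => w_nonneg n y) n ?_
    change 0 < (1 / 2 : ℝ) ^ n * min (F n y ^ 2) 1
    positivity
  have g_le (N : ℕ) : χ g ≤ 2 * (1 / 2) ^ N := by
    have h : ∀ y, (g - ∑ n ∈ Finset.range N, w n) y ≤
        ContinuousMap.const Y (2 * (1 / 2 : ℝ) ^ N) y := by
      intro y
      have h1 : g y - ∑ n ∈ Finset.range N, w n y = ∑' n, w (n + N) y := by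
        rw [sub_eq_iff_eq_add']
        exact ((w_summable y).sum_add_tsum_nat_add N).symm
      have h2 : ∑' n, w (n + N) y ≤ ∑' n, (1 / 2 : ℝ) ^ n * (1 / 2) ^ N :=
        Summable.tsum_le_tsum (fun n => (w_le _ y).trans_eq (pow_add _ _ _))
          ((summable_nat_add_iff N).2 (w_summable y)) (summable_geometric_two.mul_right _)
      rw [tsum_mul_right, tsum_geometric_two] at h2
      simpa [ContinuousMap.sum_apply, h1] using h2
    have h3 := ContinuousMap.ringHom_mono χ h
    rwa [map_sub, map_sum, Finset.sum_eq_zero fun n _ => χw n, sub_zero,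
      ContinuousMap.ringHom_apply_const] at h3
  have lim : Filter.Tendsto (fun N : ℕ => 2 * (1 / 2 : ℝ) ^ N) Filter.atTop (𝓝 (2 * 0)) :=
    (tendsto_pow_atTop_nhds_zero_of_lt_one (by norm_num) (by norm_num)).const_mul 2
  rw [mul_zero] at lim
  exact ContinuousMap.ringHom_ne_zero χ (fun y => (g_pos y).ne')
    (le_antisymm (ge_of_tendsto' lim g_le)
      (ContinuousMap.ringHom_nonneg χ fun y => (g_pos y).le))

/-- Lindelöf spaces are realcompact: every real character of `C(Y, ℝ)` is a point evaluation. -/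
theorem ContinuousMap.exists_eval_of_ringHom [LindelofSpace Y] (χ : C(Y, ℝ) →+* ℝ) :
    ∃ y, ∀ f, χ f = f y := by
  by_contra! hne
  choose f hf using hne
  let F : Y → C(Y, ℝ) := fun y => f y - ContinuousMap.const Y (χ (f y))
  have χF (y : Y) : χ (F y) = 0 := by
    rw [map_sub, ContinuousMap.ringHom_apply_const, sub_self]
  have hF (y : Y) : F y y ≠ 0 := sub_ne_zero.2 (hf y).symm
  obtain ⟨t, ht, htU⟩ := LindelofSpace.elim_nhds_subcover (fun y => {z | F y z ≠ 0})
    fun y => (isOpen_ne_fun (F y).continuous continuous_const).mem_nhds (hF y)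
  -- Enumerating `t` by `ℕ` needs `t` nonempty. The zero family has a common zero, so `Y` has a
  -- point, which `t` must cover.
  have ne : t.Nonempty := by
    obtain ⟨y, -⟩ := ContinuousMap.exists_common_zero_of_ringHom χ (fun _ => 0) fun _ => map_zero χ
    have hy : y ∈ ⋃ x ∈ t, {z | F x z ≠ 0} := htU ▸ Set.mem_univ y
    obtain ⟨x, hx, -⟩ := Set.mem_iUnion₂.1 hy
    exact ⟨x, hx⟩
  obtain ⟨e, rfl⟩ := ht.exists_eq_range ne
  obtain ⟨y, hy⟩ := ContinuousMap.exists_common_zero_of_ringHom χ (fun n => F (e n)) fun n => χF _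
  have hy' : y ∈ ⋃ x ∈ Set.range e, {z | F x z ≠ 0} := htU ▸ Set.mem_univ y
  obtain ⟨x, ⟨n, rfl⟩, hx⟩ := Set.mem_iUnion₂.1 hy'
  exact hx (hy n)

end RingHomToReal

section CompletelyRegular

variable {K : Type*} [TopologicalSpace K] [T35Space K]

theorem T35Space.eq_of_forall_continuousMap {x y : K} (h : ∀ f : C(K, ℝ), f x = f y) : x = y := by
  by_contra hxy
  obtain ⟨f, hf, hfx, hfy⟩ := CompletelyRegularSpace.completely_regular x {y} isClosed_singleton
    (by simpa using hxy)
  have := h ⟨fun z => (f z : ℝ), by fun_prop⟩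
  simp [hfx, hfy rfl] at this

/-- Complete regularity makes the topology of `K` the initial one for its real functions. -/
theorem T35Space.continuous_of_forall_continuousMap {Y : Type*} [TopologicalSpace Y] {p : Y → K}
    (h : ∀ f : C(K, ℝ), Continuous fun y => f (p y)) : Continuous p := by
  rw [continuous_iff_continuousAt]
  intro y U hU
  obtain ⟨V, hVU, hV, hyV⟩ := mem_nhds_iff.1 hU
  obtain ⟨f, hf, hfy, hfV⟩ := CompletelyRegularSpace.completely_regular (p y) Vᶜ hV.isClosed_compl
    (by simpa using hyV)
  have hc := h ⟨fun z => (f z : ℝ), by fun_prop⟩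
  have ho : IsOpen {z | ((f (p z) : unitInterval) : ℝ) < 1} := isOpen_lt hc continuous_const
  have hy : y ∈ {z | ((f (p z) : unitInterval) : ℝ) < 1} := by simp [hfy]
  refine Filter.mem_map.2 <| Filter.mem_of_superset (ho.mem_nhds hy) fun z hz => Set.mem_preimage.2 (hVU ?_)
  by_contra hzV
  have : ((f (p z) : unitInterval) : ℝ) < 1 := hz
  simp [hfV hzV] at this

end CompletelyRegular

section RealPoints

variable {X : Type u} [TopologicalSpace X]

/-- Restriction of a function on the Stone-Čech compactification to the space. -/
def stoneCechRestrict (X : Type u) [TopologicalSpace X] : C(StoneCech X, ℝ) →+* C(X, ℝ) where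
  toFun h := h.comp ⟨stoneCechUnit, continuous_stoneCechUnit⟩
  map_one' := rfl
  map_mul' _ _ := rfl
  map_zero' := rfl
  map_add' _ _ := rfl

@[simp]
theorem stoneCechRestrict_apply (h : C(StoneCech X, ℝ)) (a : X) :
    stoneCechRestrict X h a = h (stoneCechUnit a) := rfl

/-- A bounded function extends to the Stone-Čech compactification. -/
theorem exists_stoneCechRestrict_eq (f : C(X, ℝ)) (C : ℝ) (hf : ∀ a, |f a| ≤ C) :
    ∃ h : C(StoneCech X, ℝ), stoneCechRestrict X h = f := by
  let b : X → Set.Icc (-C) C := fun a => ⟨f a, abs_le.1 (hf a)⟩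
  have hb : Continuous b := f.continuous.subtype_mk _
  refine ⟨⟨fun x => ((stoneCechExtend hb x : Set.Icc (-C) C) : ℝ),
    continuous_subtype_val.comp (continuous_stoneCechExtend hb)⟩, ?_⟩
  ext a
  exact congrArg Subtype.val (stoneCechExtend_stoneCechUnit hb a)

/-- A point of the Stone-Čech compactification is real as soon as evaluation at it extends to a real
character of `C(X, ℝ)`. -/
theorem IsRealPoint.of_ringHom {x : StoneCech X} (χ : C(X, ℝ) →+* ℝ)
    (hχ : ∀ h, χ (stoneCechRestrict X h) = h x) : IsRealPoint x := by
  intro f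
  have pos (a : X) : 0 < 1 + |f a| := by positivity
  -- The bounded function `b` extends to `βX`, and `f = b / (1 - |b|)`. Since `1 - |b|` is a unit of
  -- `C(X)`, `χ` shows that its extension does not vanish at `x`.
  let b : C(X, ℝ) := ⟨fun a => f a / (1 + |f a|),
    f.continuous.div (by fun_prop) fun a => (pos a).ne'⟩
  have abs_b (a : X) : |b a| = |f a| / (1 + |f a|) := by
    change |f a / (1 + |f a|)| = _
    rw [abs_div, abs_of_pos (pos a)]
  have one_sub (a : X) : 1 - |b a| = (1 + |f a|)⁻¹ := by
    rw [abs_b]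
    have := (pos a).ne'
    field_simp
    ring
  obtain ⟨h, hh⟩ := exists_stoneCechRestrict_eq b 1 fun a => by
    rw [abs_b, div_le_one (pos a)]
    linarith
  have hh' (a : X) : h (stoneCechUnit a) = b a := DFunLike.congr_fun hh a
  let k : C(StoneCech X, ℝ) := ⟨fun z => 1 - |h z|, by fun_prop⟩
  have k_unit (a : X) : k (stoneCechUnit a) ≠ 0 := by
    change 1 - |h (stoneCechUnit a)| ≠ 0
    rw [hh', one_sub]
    exact inv_ne_zero (pos a).ne'
  have k_x : k x ≠ 0 := by
    rw [← hχ]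
    exact ContinuousMap.ringHom_ne_zero χ k_unit
  refine ⟨⟨fun z => h z / k z, ?_⟩, fun a => ?_⟩
  · refine Continuous.div (by fun_prop) (by fun_prop) ?_
    rintro ⟨z, ⟨a, rfl⟩ | rfl⟩
    exacts [k_unit a, k_x]
  · change h (stoneCechUnit a) / (1 - |h (stoneCechUnit a)|) = f a
    rw [hh', one_sub]
    change f a / (1 + |f a|) / (1 + |f a|)⁻¹ = f a
    have := (pos a).ne'
    field_simp

theorem isRealPoint_stoneCechUnit (a : X) : IsRealPoint (stoneCechUnit a : StoneCech X) :=
  IsRealPoint.of_ringHom (ContinuousMap.evalAlgHom ℝ ℝ a).toRingHom fun _ => rfl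

theorem eq_of_eqOn_stoneCechUnit {S : Set (StoneCech X)} {Z : Type*} [TopologicalSpace Z] [T2Space Z]
    (hS : ∀ a : X, stoneCechUnit a ∈ S) {g g' : C(S, Z)}
    (h : ∀ a, g ⟨stoneCechUnit a, hS a⟩ = g' ⟨stoneCechUnit a, hS a⟩) : g = g' := by
  have hd : DenseRange fun a : X => (⟨stoneCechUnit a, hS a⟩ : S) := by
    rw [DenseRange, Topology.IsInducing.subtypeVal.dense_iff]
    intro z
    rw [← Set.range_comp]
    exact denseRange_stoneCechUnit z.1
  exact DFunLike.ext' (hd.equalizer g.continuous g'.continuous (funext h))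

/-- Evaluation at a real point extends to a real character of `C(X, ℝ)`. -/
theorem IsRealPoint.exists_ringHom {x : StoneCech X} (hx : IsRealPoint x) :
    ∃ χ : C(X, ℝ) →+* ℝ, ∀ h, χ (stoneCechRestrict X h) = h x := by
  choose E hE using hx
  -- By density of `X`, extensions are unique, so the chosen `E` respects the ring operations.
  have key (f : C(X, ℝ))
      (g : C((Set.range (stoneCechUnit : X → StoneCech X) ∪ {x} : Set (StoneCech X)), ℝ))
      (hg : ∀ a : X, g ⟨stoneCechUnit a, Or.inl ⟨a, rfl⟩⟩ = f a) : E f = g :=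
    eq_of_eqOn_stoneCechUnit (fun a => Or.inl ⟨a, rfl⟩) fun a => (hE f a).trans (hg a).symm
  let x' : (Set.range (stoneCechUnit : X → StoneCech X) ∪ {x} : Set (StoneCech X)) :=
    ⟨x, Or.inr rfl⟩
  refine ⟨{ toFun := fun f => E f x'
            map_one' := by rw [key 1 1 fun a => rfl]; rfl
            map_zero' := by rw [key 0 0 fun a => rfl]; rfl
            map_mul' := fun f g => by
              rw [key (f * g) (E f * E g) fun a => by simp [hE]]; rfl
            map_add' := fun f g => by
              rw [key (f + g) (E f + E g) fun a => by simp [hE]]; rfl }, fun h => ?_⟩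
  change E (stoneCechRestrict X h) x' = h x
  rw [key (stoneCechRestrict X h) (h.comp ⟨Subtype.val, continuous_subtype_val⟩) fun a => rfl]
  rfl

end RealPoints

section Main

variable {X : Type u} [TopologicalSpace X]

/-- The lift places the test space `ℝ` in the universe of `X`. -/
theorem lind_ulift_real : Lind (ULift.{u} ℝ) := by
  have : T35Space (ULift.{u} ℝ) := Homeomorph.ulift.isEmbedding.t35Space
  exact ⟨this, LindelofSpace.of_continuous_surjective Homeomorph.ulift.symm.continuous
    Homeomorph.ulift.symm.surjective⟩

theorem IsFunctorialPification.nonempty_ringEquiv {νX : Type u} [TopologicalSpace νX]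
    {i : C(X, νX)} (hi : IsFunctorialPification Lind i) : Nonempty (C(X, ℝ) ≃+* C(νX, ℝ)) := by
  let r : C(νX, ℝ) →+* C(X, ℝ) := (ContinuousMap.compRightAlgHom ℝ ℝ i).toRingHom
  let up : C(ℝ, ULift.{u} ℝ) := ⟨ULift.up, continuous_uliftUp⟩
  let down : C(ULift.{u} ℝ, ℝ) := ⟨ULift.down, continuous_uliftDown⟩
  have hr : Function.Bijective r := by
    constructor
    · intro g g' h
      have h' : g.comp i = g'.comp i := h
      have := (hi.existsUnique_extension _ lind_ulift_real (up.comp (g.comp i))).unique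
        (y₁ := up.comp g) (y₂ := up.comp g') rfl (by rw [h']; rfl)
      exact congrArg down.comp this
    · intro f
      obtain ⟨g, hg, -⟩ := hi.existsUnique_extension _ lind_ulift_real (up.comp f)
      exact ⟨down.comp g, (congrArg down.comp hg).symm⟩
  exact ⟨(RingEquiv.ofBijective r hr).symm⟩

/-- If `C(X, ℝ)` is the ring of functions of a Lindelöf space `Y`, then `Y` maps continuously onto the
realcompactification of `X`. -/
theorem lindelofSpace_realcompactification {Y : Type u} [TopologicalSpace Y] [LindelofSpace Y]
    (φ : C(X, ℝ) ≃+* C(Y, ℝ)) : LindelofSpace (Realcompactification X) := by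
  let χ : Y → C(X, ℝ) →+* ℝ := fun y => (ContinuousMap.evalAlgHom ℝ ℝ y).toRingHom.comp φ.toRingHom
  have hp (y : Y) : ∃ x : StoneCech X, ∀ h, χ y (stoneCechRestrict X h) = h x :=
    -- `βX` is compact, hence Lindelöf, so its characters are evaluations.
    ContinuousMap.exists_eval_of_ringHom ((χ y).comp (stoneCechRestrict X))
  choose p hp using hp
  have cp : Continuous p := T35Space.continuous_of_forall_continuousMap fun h => by
    simp_rw [← hp]
    exact (φ (stoneCechRestrict X h)).continuous
  let q : Y → Realcompactification X := fun y => ⟨p y, IsRealPoint.of_ringHom (χ y) (hp y)⟩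
  have hq : Function.Surjective q := by
    rintro ⟨x, hx⟩
    obtain ⟨ψ, hψ⟩ := IsRealPoint.exists_ringHom hx
    obtain ⟨y, hy⟩ := ContinuousMap.exists_eval_of_ringHom (ψ.comp φ.symm.toRingHom)
    refine ⟨y, Subtype.ext (T35Space.eq_of_forall_continuousMap fun h => ?_)⟩
    change h (p y) = h x
    rw [← hp, ← hψ]
    have := hy (φ (stoneCechRestrict X h))
    simp only [RingEquiv.toRingHom_eq_coe, RingHom.coe_comp, RingHom.coe_coe, Function.comp_apply,
      RingEquiv.symm_apply_apply] at this
    exact this.symm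
  exact LindelofSpace.of_continuous_surjective (cp.subtype_mk _) hq

/-- The canonical map of a space to its realcompactification. -/
def toRealcompactification (X : Type u) [TopologicalSpace X] : C(X, Realcompactification X) :=
  ⟨fun a => ⟨stoneCechUnit a, isRealPoint_stoneCechUnit a⟩, continuous_stoneCechUnit.subtype_mk _⟩

theorem isFunctorialPification_toRealcompactification [LindelofSpace (Realcompactification X)] :
    IsFunctorialPification Lind (toRealcompactification X) where
  mem := ⟨inferInstance, inferInstance⟩
  existsUnique_extension Y _ hY f := by
    have := hY.1
    have := hY.2
    have cf : Continuous fun a => (stoneCechUnit (f a) : StoneCech Y) :=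
      continuous_stoneCechUnit.comp f.continuous
    let F : C(StoneCech X, StoneCech Y) := ⟨stoneCechExtend cf, continuous_stoneCechExtend cf⟩
    have hF (a : X) : F (stoneCechUnit a) = stoneCechUnit (f a) :=
      stoneCechExtend_stoneCechUnit cf a
    have hy (x : Realcompactification X) : ∃ y : Y, F x = stoneCechUnit y := by
      obtain ⟨χ, hχ⟩ := IsRealPoint.exists_ringHom x.2
      -- Pulled back along `f`, the character at `x` becomes evaluation at some `y`; real functions
      -- on `βY` then cannot separate `F x` from `y`.
      obtain ⟨y, hy⟩ := ContinuousMap.exists_eval_of_ringHom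
        (χ.comp (ContinuousMap.compRightAlgHom ℝ ℝ f).toRingHom)
      refine ⟨y, T35Space.eq_of_forall_continuousMap fun h => ?_⟩
      have h1 : χ (stoneCechRestrict X (h.comp F)) = h (F x) := hχ _
      have h2 : χ ((stoneCechRestrict Y h).comp f) = h (stoneCechUnit y) :=
        hy (stoneCechRestrict Y h)
      have h3 : stoneCechRestrict X (h.comp F) = (stoneCechRestrict Y h).comp f := by
        ext a
        exact congrArg h (hF a)
      rw [← h1, h3, h2]
    choose g hg using hy
    have emb : IsEmbedding (stoneCechUnit : Y → StoneCech Y) := isEmbedding_stoneCechUnit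
    have cg : Continuous g := by
      rw [emb.continuous_iff]
      have : stoneCechUnit ∘ g = fun x : Realcompactification X => F x :=
        funext fun x => (hg x).symm
      rw [this]
      fun_prop
    refine ⟨⟨g, cg⟩, ?_, fun g' hg' => ?_⟩
    · ext a
      exact emb.injective ((hF a).symm.trans (hg (toRealcompactification X a)))
    · refine eq_of_eqOn_stoneCechUnit isRealPoint_stoneCechUnit fun a => ?_
      have h1 : f a = g' (toRealcompactification X a) := DFunLike.congr_fun hg' a
      exact h1.symm.trans (emb.injective ((hF a).symm.trans (hg (toRealcompactification X a))))

end Main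

theorem mainTheorem2 (X : Type u) [TopologicalSpace X] [T35Space X] :
    List.TFAE [
      FunctoriallyPifiable Lind X,
      LindelofSpace (Realcompactification X),
      ∃ (Y : Type u) (_ : TopologicalSpace Y), Lind Y ∧ Nonempty (C(X, ℝ) ≃+* C(Y, ℝ))] := by
  tfae_have 1 → 3 := fun ⟨νX, _, _, hi⟩ => ⟨νX, _, hi.mem, hi.nonempty_ringEquiv⟩
  tfae_have 3 → 2 := by
    rintro ⟨Y, _, ⟨-, hL⟩, ⟨φ⟩⟩
    exact lindelofSpace_realcompactification φ
  tfae_have 2 → 1 := fun _ =>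
    ⟨Realcompactification X, _, _, isFunctorialPification_toRealcompactification⟩
  tfae_finish
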